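/- Let $n\ge 1$. A *permuted composition tableau* (PCT) of shape a composition $\alpha=(\alpha_1,\dots,\alpha_\ell)$ of $N$ is a filling of the left-justified diagram with $\alpha_i$ cells in the $i$-th row from the top by positive integers at most $N$ such that the entries of the first column are distinct, the rows weakly decrease from left to right, and the triple condition holds: if $i<i'$, $c$ is the entry in row $i'$ and column $j+1$, and $a,b$ are the entries of row $i$ in columns $j,j+1$ (an absent cell counting as $0$), then $a\ge c$ implies $b>c$. It is *standard* (SPCT) if all its entries are distinct. Its standardized $j$-th column word $\mathrm{st}_j(\tau)$ is the standardization of the word of entries of column $j$ read from top to bottom; $\tau$ is a *composition tableau* if $\mathrm{st}_1(\tau)$ is the identity. A pair $(\sigma,\gamma)\in S_n\times S_n$ is *compatible* if there are a composition tableau $\tau$ (of arbitrary shape) and an index $j\ge1$ such that columns $j$ and $j+1$ of $\tau$ both have $n$ cells and $(\sigma,\gamma)=(\mathrm{st}_j(\tau),\mathrm{st}_{j+1}(\tau))$. It is *allowable* if (i) for $i<j$, $\sigma(i)>\sigma(j)$ implies $\gamma(i)>\gamma(j)$, and (ii) there are no $i<j<k$ with $\sigma(i)<\sigma(j)<\sigma(k)$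 and $\gamma(j)<\gamma(k)<\gamma(i)$. A labeled binary tree on $n$ nodes is a plane binary tree (each node has at most one left and at most one right child) whose nodes carry distinct labels from $\{1,\dots,n\}$; a *right ascent* is an edge from a node to its right child such that the child has the larger label. **Theorem.** The set $\{(\mathrm{st}_1(\tau),\mathrm{st}_2(\tau)) : \tau \text{ an SPCT of shape } (2^n)\}$ is in bijection with the set of labeled binary trees on $n$ nodes with no right ascents, and it has $(n+1)^{n-1}$ elements. Moreover, a pair $(\sigma,\gamma)\in S_n\times S_n$ is compatible if and only if it is allowable, if and only if it belongs to this set; every allowable pair equals $(\mathrm{st}_{k-1}(\tau),\mathrm{st}_k(\tau))$ for some standard composition tableau $\tau$ of shape $(k^n)$ with $k\ge2$. Hence the number of compatible pairs and the number of allowable pairs in $S_n$ are both $(n+1)^{n-1}$. -/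

import Mathlib

namespace PermutedTableaux

/-- The standardization of a word `w` of length `m`, as a permutation of the `m` positions in
one-line notation: the letter at position `i` is replaced by its rank, equal letters being ranked
from left to right. It is characterized by `stan_eq_iff` below. -/
def stan {m : ℕ} (w : Fin m → ℕ) : Equiv.Perm (Fin m) := (Tuple.sort w)⁻¹

/-- For `i < j`, the standardization has an inversion at `(i, j)` exactly when the word has. -/
theorem stan_lt_iff {m : ℕ} (w : Fin m → ℕ) {i j : Fin m} (hij : i < j) :
    stan w j < stan w i ↔ w j < w i := by
  have h : ∀ a b : Fin m, stan w a < stan w b → w a < w b ∨ (w a = w b ∧ a < b) := by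
    intro a b hab
    have hm := Tuple.monotone_sort w hab.le
    have ha : Tuple.sort w (stan w a) = a := by simp [stan]
    have hb : Tuple.sort w (stan w b) = b := by simp [stan]
    simp only [Function.comp_apply, ha, hb] at hm
    rcases hm.lt_or_eq with h1 | h1
    · exact Or.inl h1
    · refine Or.inr ⟨h1, ?_⟩
      have h2 := (Tuple.eq_sort_iff.1 (rfl : Tuple.sort w = Tuple.sort w)).2 _ _ hab
      rw [ha, hb] at h2
      exact h2 h1
  constructor
  · intro hlt
    rcases h j i hlt with h1 | h1
    · exact h1
    · exact absurd hij (not_lt.2 h1.2.le)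
  · intro hw
    by_contra hn
    have hne : stan w i ≠ stan w j := fun e => hij.ne ((stan w).injective e)
    rcases h i j (lt_of_le_of_ne (not_lt.1 hn) hne) with h1 | h1 <;> omega

/-- The standardization is the unique permutation with the inversions of the word. -/
theorem stan_eq_iff {m : ℕ} (w : Fin m → ℕ) (σ : Equiv.Perm (Fin m)) :
    stan w = σ ↔ ∀ i j : Fin m, i < j → (σ j < σ i ↔ w j < w i) := by
  constructor
  · rintro rfl i j hij
    exact stan_lt_iff w hij
  · intro h
    have hs : ∀ i j : Fin m, stan w i < stan w j ↔ σ i < σ j := by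
      intro i j
      rcases lt_trichotomy i j with hij | rfl | hij
      · have h1 := (stan_lt_iff w hij).trans (h i j hij).symm
        have h2 : stan w i ≠ stan w j := fun e => hij.ne ((stan w).injective e)
        have h3 : σ i ≠ σ j := fun e => hij.ne (σ.injective e)
        constructor
        · intro hl
          exact lt_of_le_of_ne (not_lt.1 fun hg => lt_asymm hl (h1.2 hg)) h3
        · intro hl
          exact lt_of_le_of_ne (not_lt.1 fun hg => lt_asymm hl (h1.1 hg)) h2
      · simp
      · exact (stan_lt_iff w hij).trans (h j i hij).symm
    have hmono : StrictMono (σ.symm.trans (stan w)) := by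
      intro a b hab
      simpa using (hs (σ.symm a) (σ.symm b)).2 (by simpa using hab)
    have hid : σ.symm.trans (stan w) = Equiv.refl _ :=
      (Equiv.Perm.monotone_iff _).1 hmono.monotone
    ext1 i
    have := congrArg (fun e => e (σ i)) hid
    simpa using this

/-- A permuted composition tableau of shape the composition `α` of `N` (rows counted from the top,
columns from the left, both starting at `0`; row `i` has the cells `j < α.blocksFun i`), with
positive entries that are at most `N`. The value of `entry` outside the diagram is `0`; hence in
the triple condition, where the cells containing `a = entry i j` and `b = entry i (j + 1)` may lie
outside the diagram, an absent cell counts as a cell with entry `0`. -/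
structure PCT {N : ℕ} (α : Composition N) where
  entry : Fin α.length → ℕ → ℕ
  pos : ∀ i j, j < α.blocksFun i → 0 < entry i j
  le_size : ∀ i j, entry i j ≤ N
  zero_outside : ∀ i j, α.blocksFun i ≤ j → entry i j = 0
  first_column_injective : Function.Injective fun i => entry i 0
  row_weakly_decreasing : ∀ i j, j + 1 < α.blocksFun i → entry i (j + 1) ≤ entry i j
  triple : ∀ i i' j, i < i' → j + 1 < α.blocksFun i' →
    entry i' (j + 1) ≤ entry i j → entry i' (j + 1) < entry i (j + 1)

/-- The rows of the diagram of `α` that have a cell in column `j`. -/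
def colRows {N : ℕ} (α : Composition N) (j : ℕ) : Finset (Fin α.length) :=
  Finset.univ.filter fun i => j < α.blocksFun i

namespace PCT

variable {N : ℕ} {α : Composition N}

/-- A tableau is standard if its entries are all distinct. -/
def IsStandard (τ : PCT α) : Prop :=
  ∀ i j i' j', j < α.blocksFun i → j' < α.blocksFun i' →
    τ.entry i j = τ.entry i' j' → i = i' ∧ j = j'

/-- The type of a tableau: the standardization of its first column. -/
def type (τ : PCT α) : Equiv.Perm (Fin α.length) := stan fun i => τ.entry i 0

/-- Composition tableaux are the permuted composition tableaux whose type is the identity. -/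
def IsCompositionTableau (τ : PCT α) : Prop := τ.type = 1

/-- The word of the entries of column `j`, which has `n` cells, read from top to bottom. -/
def colWord (τ : PCT α) (j : ℕ) {n : ℕ} (h : (colRows α j).card = n) : Fin n → ℕ :=
  fun r => τ.entry ((colRows α j).orderEmbOfFin h r) j

/-- The standardized column word of column `j`, which has `n` cells. -/
def st (τ : PCT α) (j : ℕ) {n : ℕ} (h : (colRows α j).card = n) : Equiv.Perm (Fin n) :=
  stan (τ.colWord j h)

end PCT

/-- The composition `(kⁿ)` consisting of `n` parts equal to `k`. -/
def rect (n k : ℕ) (hk : 0 < k) : Composition (n * k) where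
  blocks := List.replicate n k
  blocks_pos := fun h => (List.eq_of_mem_replicate h).symm ▸ hk
  blocks_sum := by simp

theorem card_colRows_rect (n k : ℕ) (hk : 0 < k) (j : ℕ) (hj : j < k) :
    (colRows (rect n k hk) j).card = n := by
  have h : ∀ i, (rect n k hk).blocksFun i = k := fun i =>
    List.eq_of_mem_replicate ((rect n k hk).blocksFun_mem_blocks i)
  have hl : (rect n k hk).length = n := by simp [rect, Composition.length]
  simp [colRows, h, hj, hl]

/-- The pairs of standardized first and second column words of the standard permuted composition
tableaux of shape `(2ⁿ)`. -/
def twoColumnPairs (n : ℕ) : Set (Equiv.Perm (Fin n) × Equiv.Perm (Fin n)) :=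
  {p | ∃ τ : PCT (rect n 2 two_pos), τ.IsStandard ∧
    τ.st 0 (card_colRows_rect n 2 two_pos 0 two_pos) = p.1 ∧
    τ.st 1 (card_colRows_rect n 2 two_pos 1 one_lt_two) = p.2}

/-- `(σ, γ)` is compatible if it consists of the standardized column words of two adjacent columns,
with `n` cells each, of some composition tableau of arbitrary shape. -/
def IsCompatible {n : ℕ} (σ γ : Equiv.Perm (Fin n)) : Prop :=
  ∃ (N : ℕ) (α : Composition N) (τ : PCT α) (j : ℕ)
    (h : (colRows α j).card = n) (h' : (colRows α (j + 1)).card = n),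
    τ.IsCompositionTableau ∧ τ.st j h = σ ∧ τ.st (j + 1) h' = γ

/-- `(σ, γ)` is allowable if it is `(21, 12)`-avoiding and `(123, 312)`-avoiding. -/
def IsAllowable {n : ℕ} (σ γ : Equiv.Perm (Fin n)) : Prop :=
  (∀ i j, i < j → σ j < σ i → γ j < γ i) ∧
  (∀ i j k, i < j → j < k → σ i < σ j → σ j < σ k → ¬ (γ j < γ k ∧ γ k < γ i))

/-- The labels of the nodes of a plane binary tree. -/
def labels {β : Type*} : BinaryTree β → List β
  | .nil => []
  | .node a l r => a :: (labels l ++ labels r)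

/-- Labeled plane binary trees on `n` nodes: the labels are distinct and drawn from an `n`-element
totally ordered set. -/
def LTree (n : ℕ) : Type :=
  {T : BinaryTree (Fin n) // T.numNodes = n ∧ (labels T).Nodup}

/-- `1` if the tree given as second argument has a root with label larger than `a`, else `0`. -/
def ascTo {n : ℕ} (a : Fin n) : BinaryTree (Fin n) → ℕ
  | .nil => 0
  | .node b _ _ => if a < b then 1 else 0

/-- The number of right ascents: edges from a node to its right child with a larger label. -/
def rasc {n : ℕ} : BinaryTree (Fin n) → ℕ
  | .nil => 0
  | .node a l r => rasc l + rasc r + ascTo a r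

end PermutedTableaux

/-!
All counts reduce to the set of allowable pairs. Write `a_r ≥ b_r` for the entries of the rows of
two adjacent full columns. The triple condition says that `b_s > a_r` whenever `r < s` and
`b_r ≤ b_s`, and this forces the standardized column words `(σ, γ)` to be allowable
(`PCT.isAllowable`).
Conversely, allowability amounts to the single condition `isAllowable_iff`: if `p < r` and
`γ p < γ r ≤ γ q`, then `σ p < σ q`. It says exactly that the entry `b_q`, if placed just above all
those `a_p` which it must exceed, remains below `a_q`. Hence any array with last column ordered as
`σ` can be extended by a column ordered as `γ` (`IsStandardArray.extend`). Starting from `σ` this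
gives the two-column tableaux, and starting from the identity and ascending to `σ` in the weak order,
whose covering pairs are allowable (`isAllowable_swap`), it gives the standard composition tableaux.

For the enumeration, list the positions `γ⁻¹ v` in the order of the values `v`, together with the
values `σ (γ⁻¹ v)`. The condition becomes that once a position is exceeded, all values of `σ` from
there on are larger. So at the letter with the largest position the word splits into a first part,
which has the smallest values of `σ`, a free choice of the value at this letter, and an independent
second part (`dominatingWordEquiv`). If there are `c + 1` letters, this gives the recurrence
`f (c + 1) = ∑ k, (c choose k) * (c + 1 - k) * f k * f (c - k)`. The trees without right ascents
satisfy it as well: the chain of right children of the root is decreasing, hence it can be rebuilt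
from its set of nodes, and one may remove the node of the chain that carries a fixed label in
its left subtree or at itself (`descentTreeEquiv`). Abel's binomial identity (`abel_recurrence`)
shows that `(n + 1) ^ (n - 1)` solves the recurrence.
-/

namespace PermutedTableaux

/-! ### Abel's binomial identity -/

open Polynomial in
/-- Abel's binomial identity as an identity of polynomials: both sides have the same derivative by
induction, and at `-1` the left side is an iterated difference of order `m` of a polynomial of
degree `m - 1`. -/
theorem abel_polynomial (m : ℕ) :
    ∑ k ∈ Finset.range (m + 1),
      C ((m.choose k : ℚ) * ((k : ℚ) + 1) ^ (k - 1)) * (X - C (k : ℚ)) ^ (m - k) = (X + 1) ^ m := by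
  induction m with
  | zero => simp
  | succ m ih =>
    rw [← sub_eq_zero]
    set D : ℚ[X] := ∑ k ∈ Finset.range (m + 1 + 1),
      C (((m + 1).choose k : ℚ) * ((k : ℚ) + 1) ^ (k - 1)) * (X - C (k : ℚ)) ^ (m + 1 - k)
        - (X + 1) ^ (m + 1) with hD
    have hder : derivative D = 0 := by
      have h1 : derivative D = C ((m : ℚ) + 1) * (∑ k ∈ Finset.range (m + 1),
          C ((m.choose k : ℚ) * ((k : ℚ) + 1) ^ (k - 1)) * (X - C (k : ℚ)) ^ (m - k)
            - (X + 1) ^ m) := by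
        rw [hD, derivative_sub, derivative_sum, Finset.sum_range_succ, mul_sub, Finset.mul_sum]
        congr 1
        · simp only [Nat.sub_self, pow_zero, mul_one, derivative_C, add_zero]
          refine Finset.sum_congr rfl fun k hk => ?_
          have hk' : k ≤ m := by simpa [Nat.lt_succ_iff] using hk
          have h2 : m + 1 - k - 1 = m - k := by omega
          have h3 : (m.choose k : ℚ) * ((m : ℚ) + 1)
              = ((m + 1).choose k : ℚ) * ((m + 1 - k : ℕ) : ℚ) := by
            exact_mod_cast Nat.choose_mul_succ_eq m k
          simp only [derivative_C_mul, derivative_X_sub_C_pow, h2]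
          rw [← mul_assoc, ← mul_assoc, ← C_mul, ← C_mul]
          congr 2
          linear_combination (-((k : ℚ) + 1) ^ (k - 1)) * h3
        · rw [show (X + 1 : ℚ[X]) = X + C 1 by simp, derivative_X_add_C_pow]
          simp
      rw [h1, ih, sub_self, mul_zero]
    have hconst := eq_C_of_natDegree_eq_zero (derivative_eq_zero.1 hder)
    have heval : D.eval (-1) = 0 := by
      have h0 := congrFun (fwdDiff_iter_pow_eq_zero_of_lt (R := ℚ) (Nat.lt_succ_self m)) 1
      rw [fwdDiff_iter_eq_sum_shift] at h0
      rw [hD]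
      simp only [eval_sub, eval_finsetSum, eval_mul, eval_C, eval_pow, eval_X, eval_add, eval_one]
      rw [neg_add_cancel, zero_pow (Nat.succ_ne_zero m), sub_zero]
      simp only [Pi.zero_apply] at h0
      rw [← h0]
      refine Finset.sum_congr rfl fun k hk => ?_
      have hk' : k ≤ m + 1 := by simpa [Nat.lt_succ_iff] using hk
      rw [show (-1 - (k : ℚ)) = (-1) * ((k : ℚ) + 1) by ring, mul_pow]
      have h4 : ((k : ℚ) + 1) ^ m = ((k : ℚ) + 1) ^ (k - 1) * ((k : ℚ) + 1) ^ (m + 1 - k) := by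
        rcases k with _ | k
        · simp
        · rw [← pow_add]; congr 1; omega
      push_cast [nsmul_eq_mul, zsmul_eq_mul]
      rw [mul_one, add_comm (1 : ℚ), h4]
      ring
    rw [hconst] at heval ⊢
    simp only [eval_C] at heval
    rw [heval, C_0]

/-- The recurrence satisfied by `(n + 1) ^ (n - 1)`, a case of Abel's binomial identity. -/
theorem abel_recurrence (m : ℕ) :
    ∑ k ∈ Finset.range (m + 1), m.choose k *
      ((m + 1 - k) * ((k + 1) ^ (k - 1) * (m - k + 1) ^ (m - k - 1))) = (m + 2) ^ m := by
  have h := congrArg (Polynomial.eval ((m : ℚ) + 1)) (abel_polynomial m)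
  simp only [Polynomial.eval_finsetSum, Polynomial.eval_mul, Polynomial.eval_C,
    Polynomial.eval_pow, Polynomial.eval_sub, Polynomial.eval_X, Polynomial.eval_add,
    Polynomial.eval_one] at h
  have h2 : ((∑ k ∈ Finset.range (m + 1), m.choose k *
      ((m + 1 - k) * ((k + 1) ^ (k - 1) * (m - k + 1) ^ (m - k - 1))) : ℕ) : ℚ)
      = (((m + 2) ^ m : ℕ) : ℚ) := by
    push_cast
    rw [show ((m : ℚ) + 2) = m + 1 + 1 by ring, ← h]
    refine Finset.sum_congr rfl fun k hk => ?_
    have hk' : k ≤ m := by simpa [Nat.lt_succ_iff] using hk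
    obtain ⟨r, rfl⟩ := Nat.exists_eq_add_of_le hk'
    have h3 : k + r + 1 - k = r + 1 := by omega
    have h4 : k + r - k = r := by omega
    rw [h3, h4]
    have h5 : ((r : ℚ) + 1) ^ r = (r + 1) * ((r : ℚ) + 1) ^ (r - 1) := by
      rcases r with _ | r
      · simp
      · rw [← pow_succ']; rfl
    push_cast
    rw [show (k : ℚ) + r + 1 - k = r + 1 by ring, h5]
    ring
  exact_mod_cast h2

/-- The recurrence for `(n + 1) ^ (n - 1)` in the form in which it counts structures that consist of
a subset `A` of an `m`-element set, one of `m + 1 - #A` further choices, and structures of the same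
kind of sizes `#A` and `m - #A`. -/
theorem card_sigma_of_recurrence {α β : Type*} (s : Finset α) {m : ℕ} (hs : s.card = m)
    (B : Finset α → Finset β) (hB : ∀ A ⊆ s, (B A).card = m + 1 - A.card)
    (P : Finset α → β → Type*)
    (hP : ∀ A ⊆ s, ∀ b ∈ B A, Nat.card (P A b) =
      (A.card + 1) ^ (A.card - 1) * (m - A.card + 1) ^ (m - A.card - 1)) :
    Nat.card (Σ A : s.powerset, Σ b : B A, P A b) = (m + 2) ^ m := by
  have hfin : ∀ (A : s.powerset) (b : B A), Finite (P A b) := by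
    intro A b
    refine Nat.finite_of_card_ne_zero ?_
    rw [hP _ (Finset.mem_powerset.1 A.2) _ b.2]
    positivity
  rw [Nat.card_sigma]
  have h1 : ∀ A : s.powerset, Nat.card (Σ b : B A, P A b) = (m + 1 - A.1.card) *
      ((A.1.card + 1) ^ (A.1.card - 1) * (m - A.1.card + 1) ^ (m - A.1.card - 1)) := by
    intro A
    rw [Nat.card_sigma, Finset.sum_congr rfl fun b _ => hP _ (Finset.mem_powerset.1 A.2) _ b.2]
    simp [hB _ (Finset.mem_powerset.1 A.2)]
  rw [Finset.sum_congr rfl fun A _ => h1 A,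
    Finset.sum_coe_sort s.powerset fun A => (m + 1 - A.card) *
      ((A.card + 1) ^ (A.card - 1) * (m - A.card + 1) ^ (m - A.card - 1)),
    Finset.sum_powerset_apply_card fun k => (m + 1 - k) *
      ((k + 1) ^ (k - 1) * (m - k + 1) ^ (m - k - 1)), hs]
  simpa using abel_recurrence m

/-! ### Extending arrays by a column -/

/-- The first `k` columns of `e` are filled with distinct entries subject to the row condition and
the triple condition of tableaux of shape `(kⁿ)`, without a bound on the entries. Only the relative
order of the entries matters, so that new entries can be inserted between given ones. -/
structure IsStandardArray {n : ℕ} (k : ℕ) (e : Fin n → ℕ → ℕ) : Prop where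
  inj : ∀ i j i' j', j < k → j' < k → e i j = e i' j' → i = i' ∧ j = j'
  dec : ∀ i j, j + 1 < k → e i (j + 1) < e i j
  triple : ∀ i i' j, i < i' → j + 1 < k → e i' (j + 1) ≤ e i j → e i' (j + 1) < e i (j + 1)

/-- Both conditions of allowability combine into one: if the value of `γ` at `p` is exceeded further
right, then `σ` has a larger value than at `p` wherever `γ` has at least such an exceeding value.
Here `q = r` is the first condition and `q < p` is the second. -/
theorem isAllowable_iff {n : ℕ} {σ γ : Equiv.Perm (Fin n)} :
    IsAllowable σ γ ↔ ∀ p r q, p < r → γ p < γ r → γ r ≤ γ q → σ p < σ q := by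
  constructor
  · intro hall p r q h1 h2 h3
    have key : ∀ x y, x < y → γ x < γ y → σ x < σ y := by
      intro x y hxy h
      by_contra hn
      exact lt_asymm h (hall.1 x y hxy
        (lt_of_le_of_ne (not_lt.1 hn) fun e => hxy.ne' (σ.injective e)))
    by_contra hn
    have hne : q ≠ p := by rintro rfl; exact absurd h2 (not_lt.2 h3)
    have hlt : σ q < σ p := lt_of_le_of_ne (not_lt.1 hn) fun e => hne (σ.injective e)
    rcases lt_or_gt_of_ne hne with hqp | hqp
    · have hrq : γ r ≠ γ q := fun e => (hqp.trans h1).ne' (γ.injective e)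
      exact hall.2 q p r hqp h1 hlt (key p r h1 h2) ⟨h2, lt_of_le_of_ne h3 hrq⟩
    · exact hn (key p q hqp (h2.trans_le h3))
  · intro h
    constructor
    · intro i j hij h1
      by_contra hn
      have h2 : γ i < γ j := lt_of_le_of_ne (not_lt.1 hn) fun e => hij.ne (γ.injective e)
      exact lt_asymm h1 (h i j j hij h2 le_rfl)
    · rintro i j k - hjk h1 - ⟨h2, h3⟩
      exact lt_asymm h1 (h j k i hjk h2 h3.le)

/-- If column `k` of an array is ordered as `σ` and `(σ, γ)` is allowable, then the array can be
extended by a column that is ordered as `γ`. -/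
theorem IsStandardArray.extend {n k : ℕ} {e : Fin n → ℕ → ℕ} (he : IsStandardArray (k + 1) e)
    {σ γ : Equiv.Perm (Fin n)} (hσ : ∀ i i', e i k < e i' k ↔ σ i < σ i')
    (hall : IsAllowable σ γ) :
    ∃ e' : Fin n → ℕ → ℕ, IsStandardArray (k + 2) e' ∧
      (∀ i i' j, j < k + 1 → (e' i j < e' i' j ↔ e i j < e i' j)) ∧
      ∀ i i', e' i (k + 1) < e' i' (k + 1) ↔ γ i < γ i' := by
  classical
  -- The entries `e p k` that the new entry in row `q` has to exceed: those with `p` above some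
  -- `q'` whose new entry exceeds that of `p`, and is at most that of `q`. If there are none, then
  -- the supremum `g q` is `0`, and the new entry lies below all old ones.
  let below : Fin n → Finset (Fin n) := fun q =>
    Finset.univ.filter fun p => ∃ q', p < q' ∧ γ p < γ q' ∧ γ q' ≤ γ q
  let g : Fin n → ℕ := fun q => (below q).sup fun p => e p k + 1
  have hgmono : ∀ q q', γ q ≤ γ q' → g q ≤ g q' := by
    intro q q' h
    refine Finset.sup_mono fun p hp => ?_
    simp only [below, Finset.mem_filter, Finset.mem_univ, true_and] at hp ⊢
    obtain ⟨r, h1, h2, h3⟩ := hp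
    exact ⟨r, h1, h2, h3.trans h⟩
  have hge : ∀ p q, p < q → γ p < γ q → e p k + 1 ≤ g q := by
    intro p q h1 h2
    refine Finset.le_sup (f := fun p => e p k + 1) ?_
    simp only [below, Finset.mem_filter, Finset.mem_univ, true_and]
    exact ⟨q, h1, h2, le_rfl⟩
  have hle : ∀ q, g q ≤ e q k := by
    intro q
    refine Finset.sup_le fun p hp => ?_
    simp only [below, Finset.mem_filter, Finset.mem_univ, true_and] at hp
    obtain ⟨r, h1, h2, h3⟩ := hp
    exact (hσ p q).2 (isAllowable_iff.1 hall p r q h1 h2 h3)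
  -- Old entries become multiples of `n + 1`, which makes room for the new column.
  let e' : Fin n → ℕ → ℕ := fun i j =>
    if j < k + 1 then (n + 1) * (e i j + 1) else (n + 1) * g i + (γ i + 1)
  have hold : ∀ i j, j < k + 1 → e' i j = (n + 1) * (e i j + 1) := fun i j h => if_pos h
  have hnew : ∀ i, e' i (k + 1) = (n + 1) * g i + (γ i + 1) := fun i => if_neg (lt_irrefl _)
  have hlast : ∀ i i', γ i < γ i' → e' i (k + 1) < e' i' (k + 1) := by
    intro i i' h
    rw [hnew, hnew]
    have h1 := Nat.mul_le_mul_left (n + 1) (hgmono i i' h.le)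
    have h2 : (γ i : ℕ) < γ i' := h
    omega
  have hlast' : ∀ i i', e' i (k + 1) < e' i' (k + 1) ↔ γ i < γ i' := by
    intro i i'
    refine ⟨fun h => ?_, hlast i i'⟩
    by_contra hn
    rcases (not_lt.1 hn).lt_or_eq with h1 | h1
    · exact lt_asymm h (hlast _ _ h1)
    · rw [γ.injective h1] at h
      exact lt_irrefl _ h
  have hne : ∀ i i' j, j < k + 1 → e' i j ≠ e' i' (k + 1) := by
    intro i i' j hj h
    rw [hold i j hj, hnew] at h
    have h1 := (γ i').isLt
    have h2 := congrArg (· % (n + 1)) h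
    simp only [Nat.mul_mod_right, Nat.mul_add_mod] at h2
    rw [Nat.mod_eq_of_lt (by omega)] at h2
    omega
  have hcol : ∀ i i' j j', j < k + 1 → j' < k + 1 → (e' i j < e' i' j' ↔ e i j < e i' j') := by
    intro i i' j j' hj hj'
    rw [hold i j hj, hold i' j' hj', Nat.mul_lt_mul_left (Nat.succ_pos n)]
    omega
  refine ⟨e', ⟨?_, ?_, ?_⟩, fun i i' j hj => hcol i i' j j hj hj, hlast'⟩
  · intro i j i' j' hj hj' h
    rcases Nat.lt_succ_iff_lt_or_eq.1 hj with h1 | rfl <;>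
      rcases Nat.lt_succ_iff_lt_or_eq.1 hj' with h2 | rfl
    · rw [hold i j h1, hold i' j' h2] at h
      have := Nat.eq_of_mul_eq_mul_left (Nat.succ_pos n) h
      exact he.inj i j i' j' h1 h2 (by omega)
    · exact absurd h (hne _ _ _ h1)
    · exact absurd h.symm (hne _ _ _ h2)
    · refine ⟨γ.injective (le_antisymm ?_ ?_), rfl⟩
      · exact not_lt.1 fun h3 => (hlast _ _ h3).ne' h
      · exact not_lt.1 fun h3 => (hlast _ _ h3).ne h
  · intro i j hj
    rcases Nat.lt_succ_iff_lt_or_eq.1 hj with h1 | h1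
    · exact (hcol _ _ _ _ h1 (by omega)).2 (he.dec i j h1)
    · obtain rfl : j = k := by omega
      rw [hnew, hold i j (by omega)]
      have h2 := Nat.mul_le_mul_left (n + 1) (hle i)
      have h3 := (γ i).isLt
      rw [mul_add]
      omega
  · intro i i' j hii hj hle'
    rcases Nat.lt_succ_iff_lt_or_eq.1 hj with h1 | h1
    · refine (hcol _ _ _ _ h1 h1).2 (he.triple i i' j hii h1 ?_)
      exact not_lt.1 fun h => not_lt.2 hle' ((hcol _ _ _ _ (by omega) h1).2 h)
    · obtain rfl : j = k := by omega
      by_contra hn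
      have h2 : γ i < γ i' := lt_of_le_of_ne
        (not_lt.1 fun h => hn (hlast _ _ h)) fun h => hii.ne (γ.injective h)
      have h3 := Nat.mul_le_mul_left (n + 1) (hge i i' hii h2)
      rw [hnew, hold i j (by omega)] at hle'
      omega

/-! ### Covering relations of the weak order -/

/-- Composing with the transposition of the values `v` and `v + 1` changes only the order of the
two positions of these values. -/
theorem swap_values_lt_iff {n : ℕ} (σ : Equiv.Perm (Fin n)) {i j : Fin n}
    (hij : (σ i : ℕ) = σ j + 1) {p q : Fin n} (h1 : ¬ (p = i ∧ q = j)) (h2 : ¬ (p = j ∧ q = i)) :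
    (σ * Equiv.swap i j) p < (σ * Equiv.swap i j) q ↔ σ p < σ q := by
  have hi : ∀ x, x ≠ i → (σ x : ℕ) ≠ σ i := fun x hx h => hx (σ.injective (Fin.ext h))
  have hj : ∀ x, x ≠ j → (σ x : ℕ) ≠ σ j := fun x hx h => hx (σ.injective (Fin.ext h))
  have hp1 := hi p
  have hp2 := hj p
  have hq1 := hi q
  have hq2 := hj q
  simp only [Equiv.Perm.mul_apply, Equiv.swap_apply_def, Fin.lt_def]
  split_ifs <;> grind

/-- A permutation other than the identity covers a permutation in the weak order, obtained by
exchanging two consecutive values that are inverted. -/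
theorem exists_inverted_consecutive_values {n : ℕ} (σ : Equiv.Perm (Fin n)) (h : σ ≠ 1) :
    ∃ i j, i < j ∧ (σ i : ℕ) = σ j + 1 := by
  by_contra! hcon
  apply h
  have hm : StrictMono σ.symm := by
    rcases n with _ | n
    · exact fun a => a.elim0
    rw [Fin.strictMono_iff_lt_succ]
    intro v
    by_contra hn
    have hne : σ.symm v.succ ≠ σ.symm v.castSucc := fun e =>
      (Fin.castSucc_lt_succ (i := v)).ne' (σ.symm.injective e)
    exact hcon _ _ (lt_of_le_of_ne (not_lt.1 hn) hne) (by simp)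
  have h1 : σ.symm = Equiv.refl _ := (Equiv.Perm.monotone_iff _).1 hm.monotone
  ext1 x
  have := congrArg (fun e => e (σ x)) h1
  simpa using this.symm

/-- The set of inversions of a permutation. -/
def inversions {n : ℕ} (σ : Equiv.Perm (Fin n)) : Finset (Fin n × Fin n) :=
  Finset.univ.filter fun p => p.1 < p.2 ∧ σ p.2 < σ p.1

/-- A covering pair of the weak order is allowable: only one pair of positions changes its order,
whereas a violation of the second condition would change the order of two pairs. -/
theorem isAllowable_swap {n : ℕ} (σ : Equiv.Perm (Fin n)) {i j : Fin n} (hlt : i < j)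
    (hij : (σ i : ℕ) = σ j + 1) : IsAllowable (σ * Equiv.swap i j) σ := by
  have hij' : (σ * Equiv.swap i j) i < (σ * Equiv.swap i j) j := by
    simp only [Equiv.Perm.mul_apply, Equiv.swap_apply_left, Equiv.swap_apply_right, Fin.lt_def]
    omega
  constructor
  · intro p q hpq h
    refine (swap_values_lt_iff σ hij ?_ ?_).1 h
    · rintro ⟨rfl, rfl⟩
      exact lt_asymm hlt hpq
    · rintro ⟨rfl, rfl⟩
      exact lt_asymm h hij'
  · rintro p q r hpq hqr h1 h2 ⟨h3, h4⟩
    have key : ∀ x y, x < y → (σ * Equiv.swap i j) x < (σ * Equiv.swap i j) y → σ y < σ x →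
        x = i ∧ y = j := by
      intro x y hxy h h'
      by_contra hn
      refine lt_asymm h' ((swap_values_lt_iff σ hij hn ?_).1 h)
      rintro ⟨rfl, rfl⟩
      exact lt_asymm hlt hxy
    have h5 := key p q hpq h1 (h3.trans h4)
    have h6 := key p r (hpq.trans hqr) (h1.trans h2) h4
    exact hqr.ne (h5.2.trans h6.2.symm)

/-- Every permutation is the order of the last column of an array whose first column increases:
ascend from the identity in the weak order, adding one column for each covering relation. -/
theorem exists_array_of_perm {n : ℕ} (σ : Equiv.Perm (Fin n)) :
    ∃ (k : ℕ) (e : Fin n → ℕ → ℕ), IsStandardArray (k + 1) e ∧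
      (∀ i i', e i 0 < e i' 0 ↔ i < i') ∧ ∀ i i', e i k < e i' k ↔ σ i < σ i' := by
  induction h : (inversions σ).card using Nat.strong_induction_on generalizing σ with
  | _ m ih =>
  by_cases h1 : σ = 1
  · subst h1
    refine ⟨0, fun i _ => i, ⟨?_, ?_, ?_⟩, fun i i' => Iff.rfl, fun i i' => Iff.rfl⟩
    · intro i j i' j' hj hj' he
      exact ⟨Fin.ext he, by omega⟩
    · intro i j hj
      omega
    · intro i i' j _ hj
      omega
  · obtain ⟨i, j, hlt, hij⟩ := exists_inverted_consecutive_values σ h1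
    have hall := isAllowable_swap σ hlt hij
    have hcard : (inversions (σ * Equiv.swap i j)).card < (inversions σ).card := by
      refine Finset.card_lt_card (Finset.ssubset_iff_of_subset ?_ |>.2 ⟨(i, j), ?_, ?_⟩)
      · intro p hp
        simp only [inversions, Finset.mem_filter, Finset.mem_univ, true_and] at hp ⊢
        exact ⟨hp.1, hall.1 _ _ hp.1 hp.2⟩
      · simp only [inversions, Finset.mem_filter, Finset.mem_univ, true_and, Fin.lt_def]
        exact ⟨hlt, by omega⟩
      · simp only [inversions, Finset.mem_filter, Finset.mem_univ, true_and, Equiv.Perm.mul_apply,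
          Equiv.swap_apply_left, Equiv.swap_apply_right, Fin.lt_def]
        omega
    obtain ⟨k, e, he, hf, hl⟩ := ih _ (h ▸ hcard) _ rfl
    obtain ⟨e', he', hf', hl'⟩ := he.extend hl hall
    exact ⟨k + 1, e', he', fun a b => (hf' a b 0 (Nat.succ_pos k)).trans (hf a b), hl'⟩

/-! ### Tableaux and allowable pairs -/

theorem length_rect (n k : ℕ) (hk : 0 < k) : (rect n k hk).length = n := by
  simp [rect, Composition.length]

theorem blocksFun_rect (n k : ℕ) (hk : 0 < k) (i : Fin (rect n k hk).length) :
    (rect n k hk).blocksFun i = k :=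
  List.eq_of_mem_replicate ((rect n k hk).blocksFun_mem_blocks i)

/-- Replacing each entry by its rank turns an array into a standard tableau of rectangular shape. -/
theorem IsStandardArray.exists_pct {n k : ℕ} {e : Fin n → ℕ → ℕ} (he : IsStandardArray k e)
    (hk : 0 < k) :
    ∃ τ : PCT (rect n k hk), τ.IsStandard ∧ ∀ i i' j, j < k →
      (τ.entry i j < τ.entry i' j ↔
        e (Fin.cast (length_rect n k hk) i) j < e (Fin.cast (length_rect n k hk) i') j) := by
  classical
  let rk : Fin n → ℕ → ℕ := fun i j =>
    (Finset.univ.filter fun c : Fin n × Fin k => e c.1 c.2 ≤ e i j).card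
  have hmono : ∀ i j i' j', e i j ≤ e i' j' → rk i j ≤ rk i' j' := by
    intro i j i' j' h
    refine Finset.card_le_card fun c hc => ?_
    simp only [Finset.mem_filter, Finset.mem_univ, true_and] at hc ⊢
    exact hc.trans h
  have hstrict : ∀ i j i' j', j' < k → e i j < e i' j' → rk i j < rk i' j' := by
    intro i j i' j' hj' h
    refine Finset.card_lt_card (Finset.ssubset_iff_of_subset ?_ |>.2 ⟨(i', ⟨j', hj'⟩), ?_, ?_⟩)
    · intro c hc
      simp only [Finset.mem_filter, Finset.mem_univ, true_and] at hc ⊢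
      exact hc.trans h.le
    · simp
    · simpa using h
  have hlt : ∀ i j i' j', j' < k → (rk i j < rk i' j' ↔ e i j < e i' j') := fun i j i' j' hj' =>
    ⟨fun h => not_le.1 fun h' => not_le.2 h (hmono _ _ _ _ h'), hstrict i j i' j' hj'⟩
  have hinj : ∀ i j i' j', j < k → j' < k → rk i j = rk i' j' → i = i' ∧ j = j' := by
    intro i j i' j' hj hj' h
    refine he.inj i j i' j' hj hj' (le_antisymm ?_ ?_)
    · exact not_lt.1 fun h' => (hstrict _ _ _ _ hj h').ne' h
    · exact not_lt.1 fun h' => (hstrict _ _ _ _ hj' h').ne h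
  let E : Fin (rect n k hk).length → ℕ → ℕ := fun i j =>
    if j < k then rk (Fin.cast (length_rect n k hk) i) j else 0
  have hE : ∀ i j, j < k → E i j = rk (Fin.cast (length_rect n k hk) i) j := fun i j h => if_pos h
  refine ⟨⟨E, ?_, ?_, ?_, ?_, ?_, ?_⟩, ?_, ?_⟩
  · intro i j hj
    rw [blocksFun_rect] at hj
    rw [hE i j hj]
    refine Finset.card_pos.2 ⟨(Fin.cast (length_rect n k hk) i, ⟨j, hj⟩), ?_⟩
    simp
  · intro i j
    by_cases hj : j < k
    · rw [hE i j hj]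
      refine (Finset.card_le_univ _).trans ?_
      simp
    · simp [E, hj]
  · intro i j hj
    rw [blocksFun_rect] at hj
    simp [E, not_lt.2 hj]
  · intro i i' h
    simp only [hE _ 0 hk] at h
    exact Fin.cast_injective _ (hinj _ _ _ _ hk hk h).1
  · intro i j hj
    rw [blocksFun_rect] at hj
    rw [hE _ _ hj, hE _ _ (by omega)]
    exact hmono _ _ _ _ (he.dec _ _ hj).le
  · intro i i' j hii hj h
    rw [blocksFun_rect] at hj
    rw [hE _ _ hj, hE _ _ (by omega)] at h
    rw [hE _ _ hj, hE _ _ hj, hlt _ _ _ _ hj]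
    refine he.triple _ _ _ hii hj ?_
    exact not_lt.1 fun h' => not_lt.2 h (hstrict _ _ _ _ hj h')
  · intro i j i' j' hj hj' h
    rw [blocksFun_rect] at hj hj'
    simp only [hE _ _ hj, hE _ _ hj'] at h
    have := hinj _ _ _ _ hj hj' h
    exact ⟨Fin.cast_injective _ this.1, this.2⟩
  · intro i i' j hj
    simp only [hE _ _ hj]
    exact hlt _ _ _ _ hj

theorem PCT.st_rect_eq_iff {n k : ℕ} {hk : 0 < k} (τ : PCT (rect n k hk)) {j : ℕ} (hj : j < k)
    (σ : Equiv.Perm (Fin n)) :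
    τ.st j (card_colRows_rect n k hk j hj) = σ ↔ ∀ r s : Fin n, r < s →
      (σ s < σ r ↔ τ.entry (Fin.cast (length_rect n k hk).symm s) j <
        τ.entry (Fin.cast (length_rect n k hk).symm r) j) := by
  have h : (fun r : Fin n => Fin.cast (length_rect n k hk).symm r) =
      (colRows (rect n k hk) j).orderEmbOfFin (card_colRows_rect n k hk j hj) := by
    refine Finset.orderEmbOfFin_unique _ (fun r => ?_) fun a b hab => hab
    simp [colRows, blocksFun_rect, hj]
  rw [PCT.st, stan_eq_iff]
  simp only [PCT.colWord, ← h]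

/-- The standardized column words of adjacent columns with equally many cells are allowable. -/
theorem PCT.isAllowable {N : ℕ} {α : Composition N} (τ : PCT α) {j n : ℕ}
    (h : (colRows α j).card = n) (h' : (colRows α (j + 1)).card = n) :
    IsAllowable (τ.st j h) (τ.st (j + 1) h') := by
  have hsub : colRows α (j + 1) ⊆ colRows α j := by
    intro i hi
    simp only [colRows, Finset.mem_filter, Finset.mem_univ, true_and] at hi ⊢
    omega
  have heq : colRows α (j + 1) = colRows α j :=
    Finset.eq_of_subset_of_card_le hsub (by rw [h, h'])
  let f : Fin n → Fin α.length := (colRows α (j + 1)).orderEmbOfFin h'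
  have hf : StrictMono f := ((colRows α (j + 1)).orderEmbOfFin h').strictMono
  have hfb : ∀ r, j + 1 < α.blocksFun (f r) := by
    intro r
    have := (colRows α (j + 1)).orderEmbOfFin_mem h' r
    exact (Finset.mem_filter.1 this).2
  have hff : f = (colRows α j).orderEmbOfFin h :=
    Finset.orderEmbOfFin_unique _ (fun r => heq ▸ (colRows α (j + 1)).orderEmbOfFin_mem h' r) hf
  have hσ : ∀ r s, r < s →
      (τ.st j h s < τ.st j h r ↔ τ.entry (f s) j < τ.entry (f r) j) := by
    intro r s hrs
    rw [PCT.st, stan_lt_iff _ hrs]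
    simp only [PCT.colWord, hff]
  have hγ : ∀ r s, r < s → (τ.st (j + 1) h' s < τ.st (j + 1) h' r ↔
      τ.entry (f s) (j + 1) < τ.entry (f r) (j + 1)) := fun r s hrs => stan_lt_iff _ hrs
  have htr : ∀ r s, r < s → τ.entry (f s) (j + 1) ≤ τ.entry (f r) j →
      τ.entry (f s) (j + 1) < τ.entry (f r) (j + 1) := fun r s hrs =>
    τ.triple _ _ _ (hf hrs) (hfb s)
  have hrow : ∀ r, τ.entry (f r) (j + 1) ≤ τ.entry (f r) j := fun r =>
    τ.row_weakly_decreasing _ _ (hfb r)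
  constructor
  · intro r s hrs h1
    rw [hσ r s hrs] at h1
    exact (hγ r s hrs).2 (htr r s hrs ((hrow s).trans h1.le))
  · rintro r s t hrs hst h1 h2 ⟨h3, h4⟩
    have h5 := (hγ r t (hrs.trans hst)).1 h4
    have h6 : ¬ τ.entry (f t) (j + 1) < τ.entry (f s) (j + 1) := fun h7 =>
      lt_asymm h3 ((hγ s t hst).2 h7)
    have h7 : τ.entry (f s) j < τ.entry (f t) (j + 1) := not_le.1 fun h7 => h6 (htr s t hst h7)
    refine lt_asymm h1 ((hσ r s hrs).2 ?_)
    exact h7.trans (h5.trans_le (hrow r))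

theorem IsAllowable.exists_compositionTableau {n : ℕ} {σ γ : Equiv.Perm (Fin n)}
    (hall : IsAllowable σ γ) : ∃ (k : ℕ) (hk : 2 ≤ k) (τ : PCT
      (rect n k (Nat.lt_of_lt_of_le two_pos hk))), τ.IsStandard ∧ τ.IsCompositionTableau ∧
        τ.st (k - 2) (card_colRows_rect n k _ (k - 2) (by omega)) = σ ∧
        τ.st (k - 1) (card_colRows_rect n k _ (k - 1) (by omega)) = γ := by
  obtain ⟨k, e, he, hf, hl⟩ := exists_array_of_perm σ
  obtain ⟨e', he', hf', hl'⟩ := he.extend hl hall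
  obtain ⟨τ, hτ, hent⟩ := he'.exists_pct (Nat.succ_pos _)
  refine ⟨k + 2, by omega, τ, hτ, ?_, ?_, ?_⟩
  · rw [PCT.IsCompositionTableau, PCT.type, stan_eq_iff]
    intro i j hij
    rw [hent _ _ 0 (by omega), hf' _ _ 0 (by omega), hf]
    rfl
  · rw [PCT.st_rect_eq_iff]
    intro r s _
    rw [hent _ _ _ (by omega)]
    · exact ((hf' s r k (by omega)).trans (hl s r)).symm
    · omega
  · rw [PCT.st_rect_eq_iff]
    intro r s _
    rw [hent _ _ _ (by omega)]
    · exact (hl' s r).symm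
    · omega

theorem isCompatible_iff_isAllowable {n : ℕ} (σ γ : Equiv.Perm (Fin n)) :
    IsCompatible σ γ ↔ IsAllowable σ γ := by
  constructor
  · rintro ⟨N, α, τ, j, h, h', -, rfl, rfl⟩
    exact τ.isAllowable h h'
  · intro hall
    obtain ⟨k, hk, τ, -, hτ, h1, h2⟩ := hall.exists_compositionTableau
    obtain ⟨k, rfl⟩ := Nat.exists_eq_add_of_le' hk
    exact ⟨_, _, τ, k, _, _, hτ, h1, h2⟩

theorem mem_twoColumnPairs_iff {n : ℕ} (σ γ : Equiv.Perm (Fin n)) :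
    (σ, γ) ∈ twoColumnPairs n ↔ IsAllowable σ γ := by
  constructor
  · rintro ⟨τ, -, h1, h2⟩
    dsimp only at h1 h2
    rw [← h1, ← h2]
    exact τ.isAllowable _ _
  · intro hall
    have he : IsStandardArray 1 fun (i : Fin n) (_ : ℕ) => (σ i : ℕ) := by
      refine ⟨?_, ?_, ?_⟩
      · intro i j i' j' hj hj' h
        exact ⟨σ.injective (Fin.ext h), by omega⟩
      · intro i j hj
        omega
      · intro i i' j _ hj
        omega
    obtain ⟨e', he', hf', hl'⟩ := he.extend (fun _ _ => Iff.rfl) hall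
    obtain ⟨τ, hτ, hent⟩ := he'.exists_pct (Nat.succ_pos _)
    refine ⟨τ, hτ, ?_, ?_⟩
    · rw [PCT.st_rect_eq_iff]
      intro r s _
      rw [hent _ _ _ (by omega)]
      · exact (hf' s r 0 (by omega)).symm
      · omega
    · rw [PCT.st_rect_eq_iff]
      intro r s _
      rw [hent _ _ _ (by omega)]
      · exact (hl' s r).symm
      · omega

/-! ### Trees without right ascents -/

/-- The binary trees without right ascents whose nodes are labeled bijectively by `S`. -/
def DescentTree {n : ℕ} (S : Finset (Fin n)) : Type :=
  {t : BinaryTree (Fin n) // (labels t).Nodup ∧ (labels t).toFinset = S ∧ rasc t = 0}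

/-- Insert a node with label `a` and left subtree `l` into the chain of right children that starts
at the root of a tree, in front of the first node of this chain with a label smaller than `a`. -/
def insertChain {n : ℕ} (a : Fin n) (l : BinaryTree (Fin n)) :
    BinaryTree (Fin n) → BinaryTree (Fin n)
  | .nil => .node a l .nil
  | .node b l' r => if b < a then .node a l (.node b l' r) else .node b l' (insertChain a l r)

theorem labels_insertChain_perm {n : ℕ} (a : Fin n) (l t : BinaryTree (Fin n)) :
    (labels (insertChain a l t)).Perm (a :: (labels l ++ labels t)) := by
  induction t with
  | nil => simp [insertChain, labels]
  | node b l' r _ ih =>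
    simp only [insertChain]
    split_ifs with h
    · simp [labels]
    · simp only [labels]
      rw [← Multiset.coe_eq_coe] at ih ⊢
      simp only [← Multiset.cons_coe, ← Multiset.coe_add] at ih ⊢
      rw [ih]
      simp only [← Multiset.singleton_add]
      abel

theorem ascTo_insertChain {n : ℕ} (c a : Fin n) (l t : BinaryTree (Fin n)) :
    ascTo c (insertChain a l t) = 0 ↔ a ≤ c ∧ ascTo c t = 0 := by
  cases t with
  | nil => simp [insertChain, ascTo]
  | node b l' r =>
    simp only [insertChain]
    split_ifs with h <;> simp [ascTo] <;> intros <;> order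

theorem rasc_insertChain {n : ℕ} {a : Fin n} {l t : BinaryTree (Fin n)} (hl : rasc l = 0)
    (ht : rasc t = 0) : rasc (insertChain a l t) = 0 := by
  induction t with
  | nil => simp [insertChain, rasc, ascTo, hl]
  | node b l' r _ ih =>
    simp only [rasc, Nat.add_eq_zero_iff] at ht
    simp only [insertChain]
    split_ifs with h
    · simp only [rasc, Nat.add_eq_zero_iff]
      exact ⟨⟨hl, ht⟩, if_neg (not_lt.2 h.le)⟩
    · simp only [rasc, Nat.add_eq_zero_iff, ascTo_insertChain]
      exact ⟨⟨ht.1.1, ih ht.1.2⟩, not_lt.1 h, ht.2⟩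

theorem insertChain_ne_nil {n : ℕ} (a : Fin n) (l t : BinaryTree (Fin n)) :
    insertChain a l t ≠ .nil := by
  cases t with
  | nil => simp [insertChain]
  | node b l' r => simp only [insertChain]; split_ifs <;> simp

/-- An inserted node is recovered as the one whose label or left subtree contains a given label
`m` that does not occur in the tree before. -/
theorem insertChain_inj {n : ℕ} {m a a' : Fin n} {l l' t t' : BinaryTree (Fin n)}
    (hm : m ∈ a :: labels l) (hm' : m ∈ a' :: labels l') (ht : m ∉ labels t) (ht' : m ∉ labels t')
    (h : insertChain a l t = insertChain a' l' t') : a = a' ∧ l = l' ∧ t = t' := by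
  induction t generalizing t' with
  | nil =>
    cases t' with
    | nil => simpa [insertChain] using h
    | node b lb r =>
      simp only [insertChain] at h
      split_ifs at h
      · simp at h
      · simp only [BinaryTree.node.injEq] at h
        exact absurd h.2.2.symm (insertChain_ne_nil _ _ _)
  | node b lb r _ ih =>
    cases t' with
    | nil =>
      simp only [insertChain] at h
      split_ifs at h
      · simp at h
      · simp only [BinaryTree.node.injEq] at h
        exact absurd h.2.2 (insertChain_ne_nil _ _ _)
    | node b' lb' r' =>
      simp only [labels, List.mem_cons, List.mem_append, not_or] at ht ht' hm hm'
      simp only [insertChain] at h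
      split_ifs at h
      · simpa using h
      · simp only [BinaryTree.node.injEq] at h
        obtain ⟨rfl, rfl, -⟩ := h
        tauto
      · simp only [BinaryTree.node.injEq] at h
        obtain ⟨rfl, rfl, -⟩ := h
        tauto
      · simp only [BinaryTree.node.injEq] at h
        obtain ⟨rfl, rfl, h3⟩ := h
        have := ih ht.2.2 ht'.2.2 h3
        exact ⟨this.1, this.2.1, by rw [this.2.2]⟩

/-- A tree without right ascents arises by inserting the node of the chain at its root that has the
label `m` in its left subtree or at itself. -/
theorem exists_eq_insertChain {n : ℕ} {m : Fin n} {t : BinaryTree (Fin n)}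
    (hm : m ∈ labels t) (hnd : (labels t).Nodup) (ht : rasc t = 0) :
    ∃ a l t', t = insertChain a l t' ∧ m ∈ a :: labels l ∧ rasc l = 0 ∧ rasc t' = 0 := by
  induction t with
  | nil => simp [labels] at hm
  | node b lb r _ ih =>
    simp only [rasc, Nat.add_eq_zero_iff] at ht
    simp only [labels, List.nodup_cons, List.nodup_append, List.mem_append, not_or] at hnd
    by_cases h : m ∈ b :: labels lb
    · refine ⟨b, lb, r, ?_, h, ht.1.1, ht.1.2⟩
      cases r with
      | nil => rfl
      | node c lc rc =>
        have h1 : ¬ b < c := by simpa [ascTo] using ht.2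
        have h2 : b ≠ c := by
          rintro rfl
          exact hnd.1.2 (by simp [labels])
        simp [insertChain, lt_of_le_of_ne (not_lt.1 h1) h2.symm]
    · have hr : m ∈ labels r := by
        simp only [labels, List.mem_cons, List.mem_append, not_or] at hm h
        tauto
      obtain ⟨a, l, t', rfl, h1, h2, h3⟩ := ih hr hnd.2.2.1 ht.1.2
      have h4 := (ascTo_insertChain _ _ _ _).1 ht.2
      refine ⟨a, l, .node b lb t', ?_, h1, h2, ?_⟩
      · simp [insertChain, not_lt.2 h4.1]
      · simp [rasc, ht.1.1, h3, h4.2]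

/-- Trees without right ascents have decreasing chains of right children. Splitting off the node of
the chain at the root that has the label `m` in its left subtree or at itself, a tree with labels
`S` amounts to the set `A` of the remaining labels, a label `a` for that node, and two trees. -/
noncomputable def descentTreeEquiv {n : ℕ} {S : Finset (Fin n)} {m : Fin n} (hm : m ∈ S) :
    (Σ A : (S.erase m).powerset, Σ a : ↥(S \ A.1),
      DescentTree A.1 × DescentTree ((S \ A.1).erase a.1))
      ≃ DescentTree S := by
  have hmem : ∀ A ∈ (S.erase m).powerset, ∀ a ∈ S \ A, ∀ l : BinaryTree (Fin n),
      (labels l).toFinset = (S \ A).erase a → m ∈ a :: labels l := by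
    intro A hA a ha l hl
    by_cases h : m = a
    · simp [h]
    · refine List.mem_cons_of_mem _ (List.mem_toFinset.1 (hl ▸ ?_))
      refine Finset.mem_erase.2 ⟨h, Finset.mem_sdiff.2 ⟨hm, fun h' => ?_⟩⟩
      exact absurd (Finset.mem_powerset.1 hA h') (Finset.notMem_erase m S)
  refine Equiv.ofBijective (fun x => ⟨insertChain x.2.1.1 x.2.2.2.1 x.2.2.1.1, ?_⟩) ⟨?_, ?_⟩
  · obtain ⟨⟨A, hA⟩, ⟨a, ha⟩, ⟨t, ht1, ht2, ht3⟩, ⟨l, hl1, hl2, hl3⟩⟩ := x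
    have hperm := labels_insertChain_perm a l t
    have hal : a ∉ labels l := by
      rw [← List.mem_toFinset, hl2]
      exact Finset.notMem_erase _ _
    have hat : a ∉ labels t := by
      rw [← List.mem_toFinset, ht2]
      exact (Finset.mem_sdiff.1 ha).2
    have hdisj : ∀ x ∈ labels l, ∀ y ∈ labels t, x ≠ y := by
      rintro x hx _ hy rfl
      rw [← List.mem_toFinset, hl2] at hx
      rw [← List.mem_toFinset, ht2] at hy
      exact (Finset.mem_sdiff.1 (Finset.mem_of_mem_erase hx)).2 hy
    refine ⟨?_, ?_, rasc_insertChain hl3 ht3⟩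
    · rw [hperm.nodup_iff, List.nodup_cons, List.nodup_append, List.mem_append, not_or]
      exact ⟨⟨hal, hat⟩, hl1, ht1, hdisj⟩
    · dsimp only
      rw [List.toFinset_eq_of_perm _ _ hperm, List.toFinset_cons, List.toFinset_append, hl2, ht2]
      have hAS : A ⊆ S := (Finset.mem_powerset.1 hA).trans (Finset.erase_subset _ _)
      rw [← Finset.insert_union, Finset.insert_erase ha, Finset.sdiff_union_of_subset hAS]
  · rintro ⟨⟨A, hA⟩, ⟨a, ha⟩, ⟨t, ht1, ht2, ht3⟩, ⟨l, hl1, hl2, hl3⟩⟩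
      ⟨⟨A', hA'⟩, ⟨a', ha'⟩, ⟨t', ht1', ht2', ht3'⟩, ⟨l', hl1', hl2', hl3'⟩⟩ h
    have h' := congrArg Subtype.val h
    dsimp only at h'
    have hnot : ∀ A ∈ (S.erase m).powerset, ∀ t : BinaryTree (Fin n),
        (labels t).toFinset = A → m ∉ labels t := by
      rintro A hA t rfl h
      exact absurd (Finset.mem_powerset.1 hA (List.mem_toFinset.2 h)) (Finset.notMem_erase m S)
    obtain ⟨rfl, rfl, rfl⟩ := insertChain_inj (hmem A hA a ha l hl2) (hmem A' hA' a' ha' l' hl2')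
      (hnot A hA t ht2) (hnot A' hA' t' ht2') h'
    clear h h'
    obtain rfl : A = A' := ht2.symm.trans ht2'
    rfl
  · rintro ⟨t, ht1, ht2, ht3⟩
    have hmt : m ∈ labels t := by rwa [← List.mem_toFinset, ht2]
    obtain ⟨a, l, t', rfl, h1, h2, h3⟩ := exists_eq_insertChain hmt ht1 ht3
    have hperm := labels_insertChain_perm a l t'
    rw [hperm.nodup_iff, List.nodup_cons, List.nodup_append, List.mem_append, not_or] at ht1
    rw [List.toFinset_eq_of_perm _ _ hperm, List.toFinset_cons, List.toFinset_append] at ht2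
    obtain ⟨⟨hal, hat⟩, hl, ht', hdisj⟩ := ht1
    refine ⟨⟨⟨(labels t').toFinset, ?_⟩, ⟨a, ?_⟩, ⟨t', ht', rfl, h3⟩, ⟨l, hl, ?_, h2⟩⟩, rfl⟩
    · rw [Finset.mem_powerset, ← ht2]
      intro x hx
      have hxt := List.mem_toFinset.1 hx
      refine Finset.mem_erase.2 ⟨?_, by simp [hxt]⟩
      rintro rfl
      rcases List.mem_cons.1 h1 with rfl | h1
      · exact hat hxt
      · exact hdisj _ h1 _ hxt rfl
    · change a ∈ S \ (labels t').toFinset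
      rw [← ht2]
      simp [hat]
    · change (labels l).toFinset = (S \ (labels t').toFinset).erase a
      rw [← ht2]
      ext x
      simp only [List.mem_toFinset, Finset.mem_erase, Finset.mem_sdiff, Finset.mem_insert,
        Finset.mem_union]
      constructor
      · intro hx
        exact ⟨fun h => hal (h ▸ hx), Or.inr (Or.inl hx), fun h => hdisj _ hx _ h rfl⟩
      · rintro ⟨h4, h5 | h5 | h5, h6⟩
        · exact absurd h5 h4
        · exact h5
        · exact absurd h5 h6

theorem card_descentTree {n : ℕ} (S : Finset (Fin n)) :
    Nat.card (DescentTree S) = (S.card + 1) ^ (S.card - 1) := by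
  induction hc : S.card using Nat.strong_induction_on generalizing S with
  | _ c ih =>
  subst hc
  rcases S.eq_empty_or_nonempty with rfl | ⟨m, hm⟩
  · have : Unique (DescentTree (∅ : Finset (Fin n))) :=
      { default := ⟨.nil, by simp [labels], by simp [labels], rfl⟩
        uniq := by
          rintro ⟨t, h1, h2, h3⟩
          cases t with
          | nil => rfl
          | node a l r => simp [labels] at h2 }
    simp
  · obtain ⟨c, hc⟩ : ∃ c, S.card = c + 1 :=
      Nat.exists_eq_succ_of_ne_zero (Finset.card_pos.2 ⟨m, hm⟩).ne'
    have hce : (S.erase m).card = c := by rw [Finset.card_erase_of_mem hm, hc]; rfl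
    rw [← Nat.card_congr (descentTreeEquiv hm), hc]
    have hsub : ∀ A ⊆ S.erase m, A ⊆ S := fun A hA => hA.trans (Finset.erase_subset _ _)
    have hcard : ∀ A ⊆ S.erase m, (S \ A).card = c + 1 - A.card := fun A hA => by
      rw [Finset.card_sdiff_of_subset (hsub A hA), hc]
    refine card_sigma_of_recurrence (S.erase m) hce (fun A => S \ A) hcard
      (fun A a => DescentTree A × DescentTree ((S \ A).erase a)) fun A hA a ha => ?_
    have hle : A.card ≤ c := hce ▸ Finset.card_le_card hA
    have h2 : ((S \ A).erase a).card = c - A.card := by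
      rw [Finset.card_erase_of_mem ha, hcard A hA]
      omega
    rw [Nat.card_prod, ih _ (by omega) A rfl, ih _ (by omega) _ h2]

theorem length_labels {β : Type*} (t : BinaryTree β) : (labels t).length = t.numNodes := by
  induction t with
  | nil => rfl
  | node a l r hl hr => simp [labels, hl, hr]

theorem card_labeledTrees (n : ℕ) :
    Nat.card {T : LTree n // rasc T.val = 0} = (n + 1) ^ (n - 1) := by
  have h := card_descentTree (Finset.univ : Finset (Fin n))
  rw [Finset.card_univ, Fintype.card_fin] at h
  rw [← h]
  refine Nat.card_congr ⟨fun T => ⟨T.1.1, T.1.2.2, ?_, T.2⟩,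
    fun t => ⟨⟨t.1, ?_, t.2.1⟩, t.2.2.2⟩, fun _ => rfl, fun _ => rfl⟩
  · rw [← Finset.card_eq_iff_eq_univ, List.toFinset_card_of_nodup T.1.2.2, length_labels, T.1.2.1,
      Fintype.card_fin]
  · rw [← length_labels, ← List.toFinset_card_of_nodup t.2.1, t.2.2.1, Finset.card_univ,
      Fintype.card_fin]

/-! ### Words of allowable pairs -/

/-- For the first letter `y` of a word whose first component exceeds that of `x`, all letters from
`y` on have a second component larger than that of `x`. -/
def DominatesAfterRecord {α β : Type*} [LinearOrder α] [LinearOrder β] (x : α × β) :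
    List (α × β) → Prop
  | [] => True
  | y :: w => if x.1 < y.1 then ∀ z ∈ y :: w, x.2 < z.2 else DominatesAfterRecord x w

/-- The words that encode allowable pairs `(σ, γ)`, where the letter at `v` is the pair of `γ⁻¹ v`
and `σ (γ⁻¹ v)`: if the first component of a letter is exceeded later, then the second component
is smaller than those of all letters from there on. -/
def IsDominatingWord {α β : Type*} [LinearOrder α] [LinearOrder β] : List (α × β) → Prop
  | [] => True
  | x :: w => DominatesAfterRecord x w ∧ IsDominatingWord w

/-- A word of pairs is split in at most one way at a first component that does not occur before. -/
theorem append_cons_inj_of_notMem {α β : Type*} {c c' : α × β} {L L' R R' : List (α × β)}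
    (hcc : c.1 = c'.1) (hL : c.1 ∉ L.map Prod.fst) (hL' : c.1 ∉ L'.map Prod.fst)
    (h : L ++ c :: R = L' ++ c' :: R') : L = L' ∧ c = c' ∧ R = R' := by
  induction L generalizing L' with
  | nil =>
    cases L' with
    | nil => simpa using h
    | cons y L' =>
      simp only [List.nil_append, List.cons_append, List.cons.injEq] at h
      simp [h.1] at hL'
  | cons x L ih =>
    cases L' with
    | nil =>
      simp only [List.nil_append, List.cons_append, List.cons.injEq] at h
      simp [hcc, h.1] at hL
    | cons y L' =>
      simp only [List.cons_append, List.cons.injEq] at h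
      simp only [List.map_cons, List.mem_cons, not_or] at hL hL'
      have := ih hL.2 hL'.2 h.2
      exact ⟨by rw [h.1, this.1], this.2⟩

section Words

variable {α β : Type*} [LinearOrder α] [LinearOrder β]

theorem dominatesAfterRecord_append {x c : α × β} {L R : List (α × β)} (h : x.1 < c.1) :
    DominatesAfterRecord x (L ++ c :: R) ↔
      DominatesAfterRecord x L ∧ ∀ z ∈ c :: R, x.2 < z.2 := by
  induction L with
  | nil => simp [DominatesAfterRecord, h]
  | cons y L ih =>
    simp only [List.cons_append, DominatesAfterRecord]
    split_ifs
    · rw [← List.cons_append, List.forall_mem_append]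
    · exact ih

theorem dominatesAfterRecord_of_forall_le {x : α × β} {w : List (α × β)} (h : ∀ y ∈ w, y.1 ≤ x.1) :
    DominatesAfterRecord x w := by
  induction w with
  | nil => trivial
  | cons y w ih =>
    rw [DominatesAfterRecord, if_neg (not_lt.2 (h y List.mem_cons_self))]
    exact ih fun z hz => h z (List.mem_cons_of_mem _ hz)

/-- At a letter `c` with the largest first component, a dominating word splits into two independent
dominating words, the first of which has the smaller second components. -/
theorem isDominatingWord_append {c : α × β} {L R : List (α × β)} (hL : ∀ y ∈ L, y.1 < c.1)
    (hR : ∀ y ∈ R, y.1 ≤ c.1) :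
    IsDominatingWord (L ++ c :: R) ↔
      IsDominatingWord L ∧ (∀ x ∈ L, ∀ z ∈ c :: R, x.2 < z.2) ∧ IsDominatingWord R := by
  induction L with
  | nil => simp [IsDominatingWord, dominatesAfterRecord_of_forall_le hR]
  | cons y L ih =>
    rw [List.cons_append, IsDominatingWord, IsDominatingWord,
      dominatesAfterRecord_append (hL y List.mem_cons_self),
      ih fun z hz => hL z (List.mem_cons_of_mem _ hz), List.forall_mem_cons]
    simp only [List.forall_mem_cons]
    tauto

/-! ### The recurrence for words -/

/-- The set of the `k` smallest elements of `S`. -/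
def smallest (k : ℕ) (S : Finset β) : Finset β :=
  S.filter fun x => (S.filter (· < x)).card < k

theorem smallest_subset (k : ℕ) (S : Finset β) : smallest k S ⊆ S := Finset.filter_subset _ _

theorem smallest_card_eq {A S : Finset β} (hA : A ⊆ S) (h : ∀ a ∈ A, ∀ b ∈ S \ A, a < b) :
    smallest A.card S = A := by
  ext x
  rw [smallest, Finset.mem_filter]
  constructor
  · rintro ⟨hx, hlt⟩
    by_contra hn
    refine not_le.2 hlt (Finset.card_le_card fun a ha => Finset.mem_filter.2 ⟨hA ha, ?_⟩)
    exact h a ha x (Finset.mem_sdiff.2 ⟨hx, hn⟩)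
  · intro hx
    refine ⟨hA hx, Finset.card_lt_card (Finset.ssubset_iff_of_subset ?_ |>.2 ⟨x, hx, by simp⟩)⟩
    intro y hy
    rw [Finset.mem_filter] at hy
    by_contra hn
    exact lt_asymm hy.2 (h x hx y (Finset.mem_sdiff.2 ⟨hy.1, hn⟩))

theorem lt_of_mem_smallest {k : ℕ} {S : Finset β} {x y : β} (hx : x ∈ smallest k S)
    (hy : y ∈ S \ smallest k S) : x < y := by
  rw [Finset.mem_sdiff, smallest, Finset.mem_filter] at hy
  rw [smallest, Finset.mem_filter] at hx
  by_contra hn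
  refine hy.2 ⟨hy.1, lt_of_le_of_lt (Finset.card_le_card fun z hz => ?_) hx.2⟩
  rw [Finset.mem_filter] at hz ⊢
  exact ⟨hz.1, hz.2.trans_le (not_lt.1 hn)⟩

theorem card_smallest {k : ℕ} {S : Finset β} (hk : k ≤ S.card) : (smallest k S).card = k := by
  suffices h : ∃ A ⊆ S, A.card = k ∧ ∀ a ∈ A, ∀ b ∈ S \ A, a < b by
    obtain ⟨A, hA, rfl, h⟩ := h
    rw [smallest_card_eq hA h]
  induction k with
  | zero => exact ⟨∅, by simp, rfl, by simp⟩
  | succ k ih =>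
    obtain ⟨A, hA, hc, h⟩ := ih (by omega)
    have hne : (S \ A).Nonempty := by
      rw [← Finset.card_pos, Finset.card_sdiff_of_subset hA]
      omega
    have hmin := Finset.mem_sdiff.1 ((S \ A).min'_mem hne)
    refine ⟨insert ((S \ A).min' hne) A, Finset.insert_subset hmin.1 hA, ?_, ?_⟩
    · rw [Finset.card_insert_of_notMem hmin.2, hc]
    · intro a ha b hb
      simp only [Finset.mem_sdiff, Finset.mem_insert, not_or] at hb
      have hb' : b ∈ S \ A := Finset.mem_sdiff.2 ⟨hb.1, hb.2.2⟩
      rcases Finset.mem_insert.1 ha with rfl | ha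
      · exact lt_of_le_of_ne ((S \ A).min'_le b hb') (Ne.symm hb.2.1)
      · exact h a ha b hb'

/-- `w` is a dominating word whose first components enumerate `U` and whose second components
enumerate `S`. -/
def IsDominatingWordOn (U : Finset α) (S : Finset β) (w : List (α × β)) : Prop :=
  ((w.map Prod.fst).Nodup ∧ (w.map Prod.fst).toFinset = U) ∧
    ((w.map Prod.snd).Nodup ∧ (w.map Prod.snd).toFinset = S) ∧ IsDominatingWord w

/-- The dominating words whose first components enumerate `U` and whose second components
enumerate `S`. -/
def DominatingWord (U : Finset α) (S : Finset β) : Type _ :=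
  {w : List (α × β) // IsDominatingWordOn U S w}

theorem IsDominatingWordOn.append_cons {U : Finset α} {S : Finset β} {M : α} (hM : M ∈ U)
    (hmax : ∀ x ∈ U, x ≤ M) {A : Finset α} (hA : A ⊆ U.erase M) {b : β}
    (hb : b ∈ S \ smallest A.card S) {L R : List (α × β)}
    (hL : IsDominatingWordOn A (smallest A.card S) L)
    (hR : IsDominatingWordOn (U.erase M \ A) ((S \ smallest A.card S).erase b) R) :
    IsDominatingWordOn U S (L ++ (M, b) :: R) := by
  obtain ⟨⟨hL1, hL2⟩, ⟨hL3, hL4⟩, hL5⟩ := hL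
  obtain ⟨⟨hR1, hR2⟩, ⟨hR3, hR4⟩, hR5⟩ := hR
  have hLf : ∀ x ∈ L.map Prod.fst, x ∈ A := fun x hx => hL2 ▸ List.mem_toFinset.2 hx
  have hRf : ∀ x ∈ R.map Prod.fst, x ∈ U.erase M \ A := fun x hx => hR2 ▸ List.mem_toFinset.2 hx
  have hLs : ∀ x ∈ L.map Prod.snd, x ∈ smallest A.card S :=
    fun x hx => hL4 ▸ List.mem_toFinset.2 hx
  have hRs : ∀ x ∈ R.map Prod.snd, x ∈ (S \ smallest A.card S).erase b :=
    fun x hx => hR4 ▸ List.mem_toFinset.2 hx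
  have hMA : M ∉ A := fun h => Finset.notMem_erase M U (hA h)
  refine ⟨⟨?_, ?_⟩, ⟨?_, ?_⟩, (isDominatingWord_append ?_ ?_).2 ⟨hL5, ?_, hR5⟩⟩
  · rw [List.map_append, List.map_cons, List.nodup_append, List.nodup_cons]
    refine ⟨hL1, ⟨fun h => ?_, hR1⟩, ?_⟩
    · exact Finset.notMem_erase M U (Finset.mem_sdiff.1 (hRf _ h)).1
    · rintro x hx y hy rfl
      rcases List.mem_cons.1 hy with rfl | hy
      · exact hMA (hLf _ hx)
      · exact (Finset.mem_sdiff.1 (hRf _ hy)).2 (hLf _ hx)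
  · rw [List.map_append, List.map_cons, List.toFinset_append, List.toFinset_cons, hL2, hR2,
      Finset.union_insert, Finset.union_sdiff_of_subset hA, Finset.insert_erase hM]
  · rw [List.map_append, List.map_cons, List.nodup_append, List.nodup_cons]
    refine ⟨hL3, ⟨fun h => ?_, hR3⟩, ?_⟩
    · exact Finset.notMem_erase b _ (hRs _ h)
    · rintro x hx y hy rfl
      rcases List.mem_cons.1 hy with rfl | hy
      · exact (Finset.mem_sdiff.1 hb).2 (hLs _ hx)
      · exact (Finset.mem_sdiff.1 (Finset.mem_of_mem_erase (hRs _ hy))).2 (hLs _ hx)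
  · rw [List.map_append, List.map_cons, List.toFinset_append, List.toFinset_cons, hL4, hR4,
      Finset.insert_erase hb, Finset.union_sdiff_of_subset (smallest_subset _ _)]
  · intro y hy
    have h := Finset.mem_erase.1 (hA (hLf _ (List.mem_map_of_mem hy)))
    exact lt_of_le_of_ne (hmax _ h.2) h.1
  · intro y hy
    exact hmax _ (Finset.mem_of_mem_erase
      (Finset.mem_sdiff.1 (hRf _ (List.mem_map_of_mem hy))).1)
  · intro x hx z hz
    refine lt_of_mem_smallest (hLs _ (List.mem_map_of_mem hx)) ?_
    rcases List.mem_cons.1 hz with rfl | hz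
    · exact hb
    · exact Finset.mem_of_mem_erase (hRs _ (List.mem_map_of_mem hz))

theorem IsDominatingWordOn.exists_eq_append_cons {U : Finset α} {S : Finset β} {M : α}
    (hM : M ∈ U) (hmax : ∀ x ∈ U, x ≤ M) {w : List (α × β)} (hw : IsDominatingWordOn U S w) :
    ∃ A ⊆ U.erase M, ∃ b ∈ S \ smallest A.card S, ∃ L R, w = L ++ (M, b) :: R ∧
      IsDominatingWordOn A (smallest A.card S) L ∧
      IsDominatingWordOn (U.erase M \ A) ((S \ smallest A.card S).erase b) R := by
  obtain ⟨⟨hw1, hw2⟩, ⟨hw3, hw4⟩, hw5⟩ := hw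
  have hMw : M ∈ w.map Prod.fst := by rwa [← List.mem_toFinset, hw2]
  obtain ⟨⟨M', b⟩, hc, hM'⟩ := List.mem_map.1 hMw
  obtain rfl : M' = M := hM'
  obtain ⟨L, R, rfl⟩ := List.append_of_mem hc
  rw [List.map_append, List.map_cons, List.nodup_append, List.nodup_cons] at hw1 hw3
  rw [List.map_append, List.map_cons, List.toFinset_append, List.toFinset_cons] at hw2 hw4
  dsimp only at hw1 hw2 hw3 hw4
  obtain ⟨hL1, ⟨hMR, hR1⟩, hLR1⟩ := hw1
  obtain ⟨hL3, ⟨hbR, hR3⟩, hLR3⟩ := hw3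
  have hML : M' ∉ L.map Prod.fst := fun h => hLR1 _ h _ List.mem_cons_self rfl
  have hAU : (L.map Prod.fst).toFinset ⊆ U.erase M' := by
    intro x hx
    refine Finset.mem_erase.2 ⟨?_, hw2 ▸ Finset.mem_union_left _ hx⟩
    rintro rfl
    exact hML (List.mem_toFinset.1 hx)
  have hlt : ∀ y ∈ L, y.1 < M' := by
    intro y hy
    have h := Finset.mem_erase.1 (hAU (List.mem_toFinset.2 (List.mem_map_of_mem hy)))
    exact lt_of_le_of_ne (hmax _ h.2) h.1
  have hle : ∀ y ∈ R, y.1 ≤ M' := by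
    intro y hy
    refine hmax _ (hw2 ▸ ?_)
    exact Finset.mem_union_right _ (Finset.mem_insert_of_mem
      (List.mem_toFinset.2 (List.mem_map_of_mem hy)))
  obtain ⟨hL5, hsep, hR5⟩ := (isDominatingWord_append hlt hle).1 hw5
  have hSL : S \ (L.map Prod.snd).toFinset = insert b (R.map Prod.snd).toFinset := by
    rw [← hw4, Finset.union_sdiff_cancel_left]
    rw [Finset.disjoint_left]
    intro x hx hx'
    refine hLR3 x (List.mem_toFinset.1 hx) x ?_ rfl
    rwa [← List.mem_toFinset, List.toFinset_cons]
  have hsm : smallest (L.map Prod.fst).toFinset.card S = (L.map Prod.snd).toFinset := by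
    have hcard : (L.map Prod.fst).toFinset.card = (L.map Prod.snd).toFinset.card := by
      rw [List.toFinset_card_of_nodup hL1, List.toFinset_card_of_nodup hL3, List.length_map,
        List.length_map]
    rw [hcard]
    refine smallest_card_eq (hw4 ▸ Finset.subset_union_left) ?_
    intro x hx z hz
    rw [hSL, ← List.toFinset_cons, List.mem_toFinset] at hz
    rw [List.mem_toFinset, List.mem_map] at hx
    obtain ⟨x, hx, rfl⟩ := hx
    have hz' : z ∈ ((M', b) :: R).map Prod.snd := hz
    obtain ⟨y, hy, rfl⟩ := List.mem_map.1 hz'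
    exact hsep x hx y hy
  have hb : b ∈ S \ smallest (L.map Prod.fst).toFinset.card S := by
    rw [hsm, hSL]
    exact Finset.mem_insert_self _ _
  have hR2 : (R.map Prod.fst).toFinset = U.erase M' \ (L.map Prod.fst).toFinset := by
    rw [← hw2]
    ext x
    simp only [List.mem_toFinset, Finset.mem_sdiff, Finset.mem_erase, Finset.mem_union,
      Finset.mem_insert]
    constructor
    · intro hx
      refine ⟨⟨fun h => hMR (h ▸ hx), Or.inr (Or.inr hx)⟩, fun h => ?_⟩
      exact hLR1 x h x (List.mem_cons_of_mem _ hx) rfl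
    · tauto
  have hR4 : (R.map Prod.snd).toFinset =
      (S \ smallest (L.map Prod.fst).toFinset.card S).erase b := by
    rw [hsm, hSL, Finset.erase_insert]
    rwa [List.mem_toFinset]
  exact ⟨_, hAU, b, hb, L, R, rfl, ⟨⟨hL1, rfl⟩, ⟨hL3, hsm.symm⟩, hL5⟩,
    ⟨⟨hR1, hR2⟩, ⟨hR3, hR4⟩, hR5⟩⟩

/-- A dominating word is determined by the set `A` of the first components that precede their
maximum `M`, the second component `b` of the letter of `M`, and the dominating words before and
after this letter. The second components of the former are the smallest ones, hence not free. -/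
noncomputable def dominatingWordEquiv {U : Finset α} {S : Finset β} {M : α}
    (hM : M ∈ U) (hmax : ∀ x ∈ U, x ≤ M) :
    (Σ A : (U.erase M).powerset, Σ b : ↥(S \ smallest A.1.card S),
      DominatingWord A.1 (smallest A.1.card S) ×
        DominatingWord ((U.erase M) \ A.1) ((S \ smallest A.1.card S).erase b.1))
      ≃ DominatingWord U S := by
  refine Equiv.ofBijective
    (fun x => ⟨x.2.2.1.1 ++ (M, x.2.1.1) :: x.2.2.2.1, IsDominatingWordOn.append_cons hM hmax
      (Finset.mem_powerset.1 x.1.2) x.2.1.2 x.2.2.1.2 x.2.2.2.2⟩) ⟨?_, ?_⟩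
  · rintro ⟨⟨A, hA⟩, ⟨b, hb⟩, ⟨L, hL⟩, ⟨R, hR⟩⟩
      ⟨⟨A', hA'⟩, ⟨b', hb'⟩, ⟨L', hL'⟩, ⟨R', hR'⟩⟩ h
    have h' := congrArg Subtype.val h
    dsimp only at h'
    have hnot : ∀ A ∈ (U.erase M).powerset, ∀ L : List (α × β),
        (L.map Prod.fst).toFinset = A → M ∉ L.map Prod.fst := by
      rintro A hA L rfl h
      exact absurd (Finset.mem_powerset.1 hA (List.mem_toFinset.2 h)) (Finset.notMem_erase M U)
    obtain ⟨rfl, hbb, rfl⟩ := append_cons_inj_of_notMem (c := (M, b)) (c' := (M, b')) rfl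
      (hnot A hA L hL.1.2) (hnot A' hA' L' hL'.1.2) h'
    obtain rfl : b = b' := congrArg Prod.snd hbb
    clear h h'
    obtain rfl : A = A' := hL.1.2.symm.trans hL'.1.2
    rfl
  · rintro ⟨w, hw⟩
    obtain ⟨A, hA, b, hb, L, R, rfl, hL, hR⟩ := hw.exists_eq_append_cons hM hmax
    exact ⟨⟨⟨A, Finset.mem_powerset.2 hA⟩, ⟨b, hb⟩, ⟨L, hL⟩, ⟨R, hR⟩⟩, rfl⟩

theorem card_dominatingWord (U : Finset α) (S : Finset β) (hUS : U.card = S.card) :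
    Nat.card (DominatingWord U S) = (U.card + 1) ^ (U.card - 1) := by
  induction hc : U.card using Nat.strong_induction_on generalizing U S with
  | _ c ih =>
  subst hc
  rcases U.eq_empty_or_nonempty with rfl | hne
  · obtain rfl : S = ∅ := by
      rw [← Finset.card_eq_zero, ← hUS, Finset.card_empty]
    have : Unique (DominatingWord (∅ : Finset α) (∅ : Finset β)) :=
      { default := ⟨[], by simp, by simp, trivial⟩
        uniq := by
          rintro ⟨w, ⟨-, h⟩, -⟩
          cases w with
          | nil => rfl
          | cons x w => simp at h }
    simp
  · have hM := U.max'_mem hne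
    obtain ⟨c, hc⟩ : ∃ c, U.card = c + 1 :=
      Nat.exists_eq_succ_of_ne_zero (Finset.card_pos.2 hne).ne'
    have hce : (U.erase (U.max' hne)).card = c := by rw [Finset.card_erase_of_mem hM, hc]; rfl
    rw [← Nat.card_congr (dominatingWordEquiv (S := S) hM fun x hx => U.le_max' x hx), hc]
    have hle : ∀ A ⊆ U.erase (U.max' hne), A.card ≤ c := fun A hA =>
      hce ▸ Finset.card_le_card hA
    have hsm : ∀ A ⊆ U.erase (U.max' hne), (smallest A.card S).card = A.card := fun A hA =>
      card_smallest (by have := hle A hA; omega)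
    have hcard : ∀ A ⊆ U.erase (U.max' hne), (S \ smallest A.card S).card = c + 1 - A.card :=
      fun A hA => by
        rw [Finset.card_sdiff_of_subset (smallest_subset _ _), hsm A hA, ← hUS, hc]
    refine card_sigma_of_recurrence _ hce (fun A => S \ smallest A.card S) hcard
      (fun A b => DominatingWord A (smallest A.card S) ×
        DominatingWord (U.erase (U.max' hne) \ A) ((S \ smallest A.card S).erase b))
      fun A hA b hb => ?_
    have h1 : (U.erase (U.max' hne) \ A).card = c - A.card := by
      rw [Finset.card_sdiff_of_subset hA, hce]
    have h2 : ((S \ smallest A.card S).erase b).card = c - A.card := by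
      rw [Finset.card_erase_of_mem hb, hcard A hA]
      have := hle A hA
      omega
    have h3 := hle A hA
    rw [Nat.card_prod, ih _ (by omega) A _ (hsm A hA).symm rfl,
      ih _ (by omega) _ _ (h1.trans h2.symm) h1]

/-! ### The number of allowable pairs -/

theorem dominatesAfterRecord_ofFn {n : ℕ} (x : α × β) (f : Fin n → α × β) :
    DominatesAfterRecord x (List.ofFn f) ↔ ∀ r q, r ≤ q → x.1 < (f r).1 → x.2 < (f q).2 := by
  induction n with
  | zero => simp [DominatesAfterRecord]
  | succ n ih =>
    rw [List.ofFn_succ, DominatesAfterRecord, ← List.ofFn_succ]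
    split_ifs with h
    · simp only [List.forall_mem_ofFn_iff]
      exact ⟨fun h1 r q _ _ => h1 q, fun h1 q => h1 0 q (Fin.zero_le _) h⟩
    · rw [ih]
      simp only [Fin.forall_fin_succ, h, Fin.succ_le_succ_iff]
      simp

theorem isDominatingWord_ofFn {n : ℕ} (f : Fin n → α × β) :
    IsDominatingWord (List.ofFn f) ↔
      ∀ p r q, p < r → r ≤ q → (f p).1 < (f r).1 → (f p).2 < (f q).2 := by
  induction n with
  | zero => simp [IsDominatingWord]
  | succ n ih =>
    rw [List.ofFn_succ, IsDominatingWord, ih, dominatesAfterRecord_ofFn]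
    simp only [Fin.forall_fin_succ, Fin.succ_lt_succ_iff, Fin.succ_le_succ_iff]
    simp

end Words

/-- The word of an allowable pair `(σ, γ)` lists the positions and the values of `σ` in the order of
the values of `γ`. -/
noncomputable def allowableEquiv (n : ℕ) :
    {p : Equiv.Perm (Fin n) × Equiv.Perm (Fin n) // IsAllowable p.1 p.2} ≃
      DominatingWord (Finset.univ : Finset (Fin n)) (Finset.univ : Finset (Fin n)) := by
  have hiff : ∀ σ γ : Equiv.Perm (Fin n), IsDominatingWord
      (List.ofFn fun v => (γ.symm v, σ (γ.symm v))) ↔ IsAllowable σ γ := by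
    intro σ γ
    rw [isDominatingWord_ofFn, isAllowable_iff]
    constructor
    · intro h p r q h1 h2 h3
      simpa using h (γ p) (γ r) (γ q) h2 h3 (by simpa using h1)
    · intro h p r q h1 h2 h3
      exact h _ _ _ h3 (by simpa using h1) (by simpa using h2)
  have hcomp : ∀ f : Fin n → Fin n × Fin n, (List.ofFn f).map Prod.fst = List.ofFn (Prod.fst ∘ f) ∧
      (List.ofFn f).map Prod.snd = List.ofFn (Prod.snd ∘ f) := fun f =>
    ⟨List.map_ofFn, List.map_ofFn⟩
  have huniv : ∀ e : Equiv.Perm (Fin n), (List.ofFn e).Nodup ∧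
      (List.ofFn e).toFinset = Finset.univ := by
    intro e
    refine ⟨List.nodup_ofFn.2 e.injective, Finset.eq_univ_of_forall fun x => ?_⟩
    rw [List.mem_toFinset, List.mem_ofFn]
    exact e.surjective x
  refine Equiv.ofBijective (fun p => ⟨List.ofFn fun v => (p.1.2.symm v, p.1.1 (p.1.2.symm v)),
    ?_, ?_, (hiff _ _).2 p.2⟩) ⟨?_, ?_⟩
  · rw [(hcomp _).1]
    exact huniv p.1.2.symm
  · rw [(hcomp _).2]
    exact huniv (p.1.2.symm.trans p.1.1)
  · rintro ⟨⟨σ, γ⟩, h⟩ ⟨⟨σ', γ'⟩, h'⟩ heq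
    have h1 := List.ofFn_injective (congrArg Subtype.val heq)
    have h2 : γ = γ' := by
      refine Equiv.symm_bijective.injective (Equiv.ext fun v => ?_)
      exact congrArg Prod.fst (congrFun h1 v)
    subst h2
    have h3 : σ = σ' := by
      ext1 x
      simpa using congrArg Prod.snd (congrFun h1 (γ x))
    subst h3
    rfl
  · rintro ⟨w, ⟨hw1, hw2⟩, ⟨hw3, hw4⟩, hw5⟩
    have hlen : w.length = n := by
      rw [← List.length_map Prod.fst, ← List.toFinset_card_of_nodup hw1, hw2, Finset.card_univ,
        Fintype.card_fin]
    obtain ⟨f, rfl⟩ : ∃ f : Fin n → Fin n × Fin n, w = List.ofFn f :=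
      ⟨fun i => w.get (Fin.cast hlen.symm i), List.ext_getElem (by simp [hlen]) (by simp)⟩
    rw [(hcomp f).1, List.nodup_ofFn] at hw1
    rw [(hcomp f).2, List.nodup_ofFn] at hw3
    let u : Equiv.Perm (Fin n) := Equiv.ofBijective _ (Finite.injective_iff_bijective.1 hw1)
    let s : Equiv.Perm (Fin n) := Equiv.ofBijective _ (Finite.injective_iff_bijective.1 hw3)
    have hf : (fun v => (u.symm.symm v, (u.symm.trans s) (u.symm.symm v))) = f := by
      funext v
      refine Prod.ext rfl ?_
      simp only [Equiv.trans_apply, Equiv.symm_symm, Equiv.symm_apply_apply]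
      rfl
    refine ⟨⟨(u.symm.trans s, u.symm), (hiff _ _).1 ?_⟩, Subtype.ext (congrArg List.ofFn hf)⟩
    rwa [hf]

theorem ncard_isAllowable (n : ℕ) :
    {p : Equiv.Perm (Fin n) × Equiv.Perm (Fin n) | IsAllowable p.1 p.2}.ncard =
      (n + 1) ^ (n - 1) := by
  have h := card_dominatingWord (Finset.univ : Finset (Fin n)) (Finset.univ : Finset (Fin n)) rfl
  rw [Finset.card_univ, Fintype.card_fin] at h
  rw [← Nat.card_coe_set_eq, ← h]
  exact Nat.card_congr (allowableEquiv n)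

end PermutedTableaux

theorem mainTheorem1 (n : ℕ) (hn : 1 ≤ n) :
    Nonempty (PermutedTableaux.twoColumnPairs n ≃
      {T : PermutedTableaux.LTree n // PermutedTableaux.rasc T.val = 0}) ∧
    (PermutedTableaux.twoColumnPairs n).ncard = (n + 1) ^ (n - 1) ∧
    (∀ σ γ : Equiv.Perm (Fin n),
      PermutedTableaux.IsCompatible σ γ ↔ PermutedTableaux.IsAllowable σ γ) ∧
    (∀ σ γ : Equiv.Perm (Fin n),
      PermutedTableaux.IsCompatible σ γ ↔ (σ, γ) ∈ PermutedTableaux.twoColumnPairs n) ∧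
    (∀ σ γ : Equiv.Perm (Fin n), PermutedTableaux.IsAllowable σ γ →
      ∃ (k : ℕ) (hk : 2 ≤ k) (τ : PermutedTableaux.PCT
          (PermutedTableaux.rect n k (Nat.lt_of_lt_of_le two_pos hk))),
        τ.IsStandard ∧ τ.IsCompositionTableau ∧
        τ.st (k - 2) (PermutedTableaux.card_colRows_rect n k _ (k - 2) (by omega)) = σ ∧
        τ.st (k - 1) (PermutedTableaux.card_colRows_rect n k _ (k - 1) (by omega)) = γ) ∧
    {p : Equiv.Perm (Fin n) × Equiv.Perm (Fin n) |
      PermutedTableaux.IsCompatible p.1 p.2}.ncard = (n + 1) ^ (n - 1) ∧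
    {p : Equiv.Perm (Fin n) × Equiv.Perm (Fin n) |
      PermutedTableaux.IsAllowable p.1 p.2}.ncard = (n + 1) ^ (n - 1) := by
  have hset : PermutedTableaux.twoColumnPairs n =
      {p : Equiv.Perm (Fin n) × Equiv.Perm (Fin n) | PermutedTableaux.IsAllowable p.1 p.2} :=
    Set.ext fun p => PermutedTableaux.mem_twoColumnPairs_iff p.1 p.2
  have hcomp : {p : Equiv.Perm (Fin n) × Equiv.Perm (Fin n) |
      PermutedTableaux.IsCompatible p.1 p.2} =
      {p : Equiv.Perm (Fin n) × Equiv.Perm (Fin n) | PermutedTableaux.IsAllowable p.1 p.2} :=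
    Set.ext fun p => PermutedTableaux.isCompatible_iff_isAllowable p.1 p.2
  have hcard := PermutedTableaux.ncard_isAllowable n
  refine ⟨?_, hset ▸ hcard, PermutedTableaux.isCompatible_iff_isAllowable, fun σ γ =>
    (PermutedTableaux.isCompatible_iff_isAllowable σ γ).trans
      (PermutedTableaux.mem_twoColumnPairs_iff σ γ).symm,
    fun σ γ h => h.exists_compositionTableau, hcomp ▸ hcard, hcard⟩
  have htree := PermutedTableaux.card_labeledTrees n
  have : Finite {T : PermutedTableaux.LTree n // PermutedTableaux.rasc T.val = 0} :=
    Nat.finite_of_card_ne_zero (by rw [htree]; positivity)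
  have : Finite (PermutedTableaux.twoColumnPairs n) := Set.toFinite _
  rw [← Finite.card_eq]
  rw [htree, Nat.card_coe_set_eq, hset, hcard]
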